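/- Let $G$ be a finite simple graph, not necessarily connected, that has a perfect matching and contains a cycle. Let $G[K_4]$ denote the composition (lexicographic product) of $G$ with the complete graph $K_4$: its vertex set is $V(G)\times V(K_4)$, and $(v_1,u_1)$, $(v_2,u_2)$ are adjacent if and only if either $v_1v_2\in E(G)$, or $v_1=v_2$ and $u_1\neq u_2$. Then $G[K_4]$ has a nonorientable quadrangular embedding, that is, a cellular embedding in a nonorientable surface such that every face is bounded by a $4$-cycle. Here a surface is a compact $2$-manifold without boundary; in a cellular embedding every face is homeomorphic to an open disk. A surface, if disconnected, is called nonorientable when at least one of its components is nonorientable. Cellular embeddings are represented, as usual, by a rotation (a cyclic order of the incident edges) at each vertex together with a signature $\pm1$ on each edge. The face boundaries are the closed walks obtained by face tracing, and the surface is nonorientable if and only if some closed walk of the graph has product of signatures $-1$. -/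

import Mathlib

/-- The composition (lexicographic product) `G[H]`: `(v₁, u₁)` and `(v₂, u₂)` are adjacent iff
`v₁` is adjacent to `v₂` in `G`, or `v₁ = v₂` and `u₁` is adjacent to `u₂` in `H`. -/
def SimpleGraph.composition {V W : Type*} (G : SimpleGraph V) (H : SimpleGraph W) :
    SimpleGraph (V × W) where
  Adj x y := G.Adj x.1 y.1 ∨ (x.1 = y.1 ∧ H.Adj x.2 y.2)
  symm := ⟨fun _ _ h => h.elim (fun h => Or.inl h.symm) (fun h => Or.inr ⟨h.1.symm, h.2.symm⟩)⟩
  loopless := ⟨fun _ h => h.elim (fun h => G.loopless.irrefl _ h)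
    (fun h => H.loopless.irrefl _ h.2)⟩

/-- A cellular embedding of a finite graph `G` in a closed surface, given by a rotation at each
vertex (a cyclic order of the darts leaving that vertex, with respect to a local orientation of the
surface there) and a signature on each edge: `1` if the local orientations at the two ends of the
edge agree along the edge, `-1` if they disagree. If `G` is disconnected, so is the surface, with
one component for each component of `G`. -/
structure SimpleGraph.CellularEmbedding {V : Type*} (G : SimpleGraph V) where
  /-- The dart following a given dart in the rotation at its initial vertex. -/
  rot : Equiv.Perm G.Dart
  rot_fst : ∀ d : G.Dart, (rot d).fst = d.fst
  /-- All darts leaving a vertex form a single cycle of the rotation. -/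
  rot_sameCycle : ∀ d d' : G.Dart, d.fst = d'.fst → rot.SameCycle d d'
  /-- The signature of an edge (its value is irrelevant off the edges of `G`). -/
  signature : Sym2 V → ℤˣ

namespace SimpleGraph.CellularEmbedding

variable {V : Type*} {G : SimpleGraph V}

/-- The local orientation on arriving at the end of the dart `x.1`, when one starts with the local
orientation `x.2` at its initial vertex. -/
def arrivalSign (E : G.CellularEmbedding) (x : G.Dart × ℤˣ) : ℤˣ :=
  x.2 * E.signature x.1.edge

/-- One step of face tracing. A state is a dart together with the current local orientation at its
initial vertex, relative to the chosen one. Traverse the dart, update the local orientation by the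
signature of the edge, and leave by the dart that is next after the reversed dart in the rotation at
the new vertex, or previous to it if the current orientation is reversed. The orbits of this map are
the boundary walks of the faces; each face is traced by two orbits, one for each direction. -/
def faceStep (E : G.CellularEmbedding) (x : G.Dart × ℤˣ) : G.Dart × ℤˣ :=
  ((E.rot ^ (E.arrivalSign x : ℤ)) x.1.symm, E.arrivalSign x)

/-- Every face is bounded by a `4`-cycle: each boundary walk closes up after four steps and visits
four distinct vertices. An isolated vertex would lie in a face not bounded by any cycle, so there is
none. -/
def IsQuadrangular (E : G.CellularEmbedding) : Prop :=
  (∀ v : V, ∃ w : V, G.Adj v w) ∧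
    ∀ x : G.Dart × ℤˣ, E.faceStep^[4] x = x ∧
      Function.Injective fun i : Fin 4 => (E.faceStep^[(i : ℕ)] x).1.fst

/-- The effect of a walk on local orientations: `-1` if the walk is orientation-reversing. -/
def walkSign (E : G.CellularEmbedding) {u v : V} (w : G.Walk u v) : ℤˣ :=
  (w.edges.map E.signature).prod

/-- The surface is orientable (that is, all its components are) iff no closed walk in `G` is
orientation-reversing. -/
def IsOrientable (E : G.CellularEmbedding) : Prop :=
  ∀ (v : V) (w : G.Walk v v), E.walkSign w = 1

/-- The surface is nonorientable: some component of it is not orientable. -/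
def IsNonorientable (E : G.CellularEmbedding) : Prop :=
  ¬ E.IsOrientable

end SimpleGraph.CellularEmbedding

/-!
Every edge `vw` of `G` gives a copy of `K_{4,4}` in `G[K₄]`. At every vertex `(v, a)` order the
neighbors `(w, 0), …, (w, 3)` cyclically, and give the edge from `(v, a)` to `(w, b)` the signature
`(-1) ^ (a + b)`: face tracing then only ever moves both indices by `±1`, and this is a quadrangular
embedding of `K_{4,4}` in the torus, with faces `(v, a), (w, b), (v, a ± 1), (w, b ± 1)`.
If `vw` is an edge of the perfect matching, replace it by an embedding of the `K₈` on the two fibres: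
at each vertex, the three darts within the fibre are inserted in two of the four corners
(`pairNext`), and all edges within fibres have signature `-1`. This embedding is again quadrangular,
and it retains four of the eight faces of the torus: `v₀ w₃ v₁ w₀`, `v₂ w₁ v₃ w₂`, and those obtained
from these by exchanging `v` and `w`.

The pieces are joined along these four faces. Fix a cyclic permutation `σ v` of the neighbors of `v`.
Cut the faces `v₀ w₃ v₁ w₀` of the pieces of all edges `vw` at `v` along the diagonal `v₀ v₁`, and
glue the half with `w₃` to the half with `(σ v w)₀`; do the same with `v₂ w₁ v₃ w₂`. All faces are
again quadrilaterals, and the rotations of the pieces around `v` merge into one cycle at each `(v, a)`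
because each is cut open at exactly one corner, the seam of `(v, a)` (`seamIndex`). The signatures are
unaffected, so a triangle within a fibre is orientation-reversing.

In the resulting rotation (`compositionRotation`), the neighbor after `(w, b)` at `(v, a)` is
`(w, b + 1)`, with `w` replaced by `σ v w` at the seam, except for the darts within a fibre.
The three facts that make this a nonorientable quadrangular embedding are
`compositionRotation_sameCycle` (one cycle at each vertex), `compositionRotation_face` (faces are
`4`-cycles), and the sign of the triangle.
-/

/-! ### Embeddings from permutations of the neighbors -/

namespace SimpleGraph.CellularEmbedding

open Equiv

section Construction

variable {W : Type*} {H : SimpleGraph W}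

/-- The permutation of the darts that applies `ρ p` to the ends of the darts leaving `p`, where `ρ p`
is a permutation of all vertices that preserves the neighbors of `p`. -/
def dartRotation (ρ : W → Perm W) (hρ : ∀ p q, H.Adj p (ρ p q) ↔ H.Adj p q) : Perm H.Dart where
  toFun d := ⟨(d.fst, ρ d.fst d.snd), (hρ _ _).2 d.adj⟩
  invFun d := ⟨(d.fst, (ρ d.fst)⁻¹ d.snd), by
    have := hρ d.fst ((ρ d.fst)⁻¹ d.snd)
    rw [Perm.inv_def, Equiv.apply_symm_apply] at this
    exact this.1 d.adj⟩
  left_inv d := by ext <;> simp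
  right_inv d := by ext <;> simp

variable {ρ : W → Perm W} {hρ : ∀ p q, H.Adj p (ρ p q) ↔ H.Adj p q}

theorem dartRotation_zpow (n : ℤ) (d : H.Dart) :
    (dartRotation ρ hρ ^ n) d =
      (⟨(d.fst, (ρ d.fst ^ n) d.snd), by
        have key : ∀ m : ℕ, ∀ q, H.Adj d.fst ((ρ d.fst ^ m) q) ↔ H.Adj d.fst q := by
          intro m
          induction m with
          | zero => simp
          | succ m ih => intro q; rw [pow_succ', Perm.mul_apply, hρ, ih]
        obtain ⟨m, rfl | rfl⟩ := n.eq_nat_or_neg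
        · rw [zpow_natCast, key]; exact d.adj
        · rw [← key m, zpow_neg, zpow_natCast, Perm.inv_def, Equiv.apply_symm_apply]
          exact d.adj⟩ : H.Dart) := by
  induction n using Int.induction_on generalizing d with
  | zero => ext <;> simp
  | succ n ih =>
    rw [add_comm, zpow_add, Perm.mul_apply, ih]
    ext <;> simp [dartRotation, zpow_add]
  | pred n ih =>
    rw [sub_eq_add_neg, add_comm, zpow_add, Perm.mul_apply, ih]
    ext <;> simp [dartRotation, zpow_add, Perm.inv_def]

/-- The cellular embedding whose rotation at `p` is the permutation `ρ p` of the neighbors of `p`. -/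
def ofNeighborRotation (ρ : W → Perm W) (hρ : ∀ p q, H.Adj p (ρ p q) ↔ H.Adj p q)
    (hcyc : ∀ p q q', H.Adj p q → H.Adj p q' → (ρ p).SameCycle q q') (sig : Sym2 W → ℤˣ) :
    H.CellularEmbedding where
  rot := dartRotation ρ hρ
  rot_fst _ := rfl
  rot_sameCycle d d' h := by
    obtain ⟨n, hn⟩ := hcyc d.fst d.snd d'.snd d.adj (h ▸ d'.adj)
    refine ⟨n, ?_⟩
    rw [dartRotation_zpow]
    ext
    · exact h
    · exact hn
  signature := sig

/-- Face tracing for `ofNeighborRotation`, with darts replaced by pairs of vertices, so that no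
adjacency proofs have to be carried along. -/
def traceStep (ρ : W → Perm W) (sig : Sym2 W → ℤˣ) (x : (W × W) × ℤˣ) : (W × W) × ℤˣ :=
  ((x.1.2, (ρ x.1.2 ^ ((x.2 * sig s(x.1.1, x.1.2) : ℤˣ) : ℤ)) x.1.1), x.2 * sig s(x.1.1, x.1.2))

/-- Since consecutive vertices of a boundary walk are adjacent, a boundary walk of length `4` is a
cycle as soon as its opposite vertices are distinct. -/
theorem isQuadrangular_ofNeighborRotation
    (hcyc : ∀ p q q', H.Adj p q → H.Adj p q' → (ρ p).SameCycle q q') (sig : Sym2 W → ℤˣ)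
    (hdeg : ∀ p, ∃ q, H.Adj p q)
    (hface : ∀ p q s, H.Adj p q →
      (traceStep ρ sig)^[4] ((p, q), s) = ((p, q), s) ∧
      (traceStep ρ sig ((p, q), s)).1.2 ≠ p ∧
      (traceStep ρ sig (traceStep ρ sig ((p, q), s))).1.2 ≠ q) :
    (ofNeighborRotation ρ hρ hcyc sig).IsQuadrangular := by
  refine ⟨hdeg, fun x => ?_⟩
  set E := ofNeighborRotation ρ hρ hcyc sig with hE
  let π : H.Dart × ℤˣ → (W × W) × ℤˣ := fun x => (x.1.toProd, x.2)
  have hπ : Function.Injective π := by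
    rintro ⟨d, s⟩ ⟨d', s'⟩ h
    simp only [π, Prod.mk.injEq] at h
    exact Prod.ext (Dart.ext _ _ h.1) h.2
  have hstep : ∀ x, π (E.faceStep x) = traceStep ρ sig (π x) := by
    intro x
    simp only [π, faceStep, hE, ofNeighborRotation, dartRotation_zpow, traceStep, arrivalSign]
    rfl
  have hiter : ∀ k, π (E.faceStep^[k] x) = (traceStep ρ sig)^[k] (π x) := fun k =>
    (Function.Semiconj.iterate_right hstep k) x
  obtain ⟨h4, h2, h3⟩ := hface x.1.fst x.1.snd x.2 x.1.adj
  change (traceStep ρ sig)^[4] (π x) = π x at h4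
  refine ⟨hπ ((hiter 4).trans h4), ?_⟩
  -- consecutive vertices of a boundary walk are adjacent, hence distinct
  have hsnd : ∀ y, (E.faceStep y).1.fst = y.1.snd := fun y =>
    congrArg (fun z => z.1.1) (hstep y)
  have hadj : ∀ y, y.1.fst ≠ (E.faceStep y).1.fst := fun y => by
    rw [hsnd]; exact y.1.adj.ne
  have a0 := hadj x
  have a1 := hadj (E.faceStep x)
  have a2 := hadj (E.faceStep (E.faceStep x))
  have a3 := hadj (E.faceStep (E.faceStep (E.faceStep x)))
  have e4 : E.faceStep (E.faceStep (E.faceStep (E.faceStep x))) = x :=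
    hπ ((hiter 4).trans h4)
  have b0 : (E.faceStep (E.faceStep x)).1.fst ≠ x.1.fst := by
    rw [hsnd]; exact fun h => h2 ((congrArg (fun z => z.1.2) (hstep x)).symm.trans h)
  have b1 : (E.faceStep (E.faceStep (E.faceStep x))).1.fst ≠ (E.faceStep x).1.fst := by
    rw [hsnd, hsnd]
    exact fun h => h3 ((congrArg (fun z => z.1.2) (hiter 2)).symm.trans h)
  rw [e4] at a3
  intro i j hij
  fin_cases i <;> fin_cases j <;> first
    | rfl
    | (exfalso; simp only [Function.iterate_succ, Function.iterate_zero, Function.comp, id] at hij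
       first
         | exact a0 hij | exact a1 hij | exact a2 hij | exact a3 hij | exact b0 hij | exact b1 hij
         | exact a0 hij.symm | exact a1 hij.symm | exact a2 hij.symm | exact a3 hij.symm
         | exact b0 hij.symm | exact b1 hij.symm)

end Construction

end SimpleGraph.CellularEmbedding

/-! ### The rotation of the composition -/

namespace SimpleGraph

open Equiv

section Composition

variable {V : Type*}

/-- The seam of `(v, a)` in the piece of an edge `vw` is the corner between `(w, seamIndex a - 1)` and
`(w, seamIndex a)`. -/
def seamIndex : Fin 4 → Fin 4 := ![0, 0, 2, 2]

open Sum in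
/-- The rotation at `(v, a)` in the quadrangular embedding of the `K₈` of a matching edge. The
neighbors of `(v, a)` are `inl b`, in the other fibre, and `inr c`, in the fibre of `v`, for `c ≠ a`;
`inr a` is fixed. The rotation is `inl 0, inl 1, inr 1, inl 2, inr 3, inr 2, inl 3` for `a = 0` and
`inl 0, inr 0, inl 1, inr 2, inr 3, inl 2, inl 3` for `a = 1`, and adding `2` to all indices gives
those for `a = 2` and `a = 3`. -/
def pairNext (a : Fin 4) : Fin 4 ⊕ Fin 4 → Fin 4 ⊕ Fin 4
  | inl b => (![![inl 1, inr 1, inr 3, inl 0], ![inr 0, inr 2, inl 3, inl 0],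
      ![inr 1, inl 2, inl 3, inr 3], ![inl 1, inl 2, inr 2, inr 0]] : Fin 4 → Fin 4 → _) a b
  | inr c => (![![inr 0, inl 2, inl 3, inr 2], ![inl 1, inr 1, inr 3, inl 2],
      ![inl 1, inr 0, inr 2, inl 0], ![inr 1, inl 0, inl 3, inr 3]] : Fin 4 → Fin 4 → _) a c

open Sum in
/-- The inverse of `pairNext`. -/
def pairPrev (a : Fin 4) : Fin 4 ⊕ Fin 4 → Fin 4 ⊕ Fin 4
  | inl b => (![![inl 3, inl 0, inr 1, inr 2], ![inl 3, inr 0, inr 3, inl 2],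
      ![inr 3, inr 0, inl 1, inl 2], ![inr 1, inl 0, inl 1, inr 2]] : Fin 4 → Fin 4 → _) a b
  | inr c => (![![inr 0, inl 1, inr 3, inl 2], ![inl 0, inr 1, inl 1, inr 2],
      ![inr 1, inl 0, inr 2, inl 3], ![inl 3, inr 0, inl 2, inr 3]] : Fin 4 → Fin 4 → _) a c

theorem pairPrev_pairNext : ∀ a x, pairPrev a (pairNext a x) = x := by decide

theorem pairNext_pairPrev : ∀ a x, pairNext a (pairPrev a x) = x := by decide

variable (μ : V → V) (σ : V → Perm V)

/-- The neighbor of a vertex over `v` that is encoded by an element of `Fin 4 ⊕ Fin 4` as in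
`pairNext`, where `μ v` is the vertex matched to `v`. -/
def place (v : V) : Fin 4 ⊕ Fin 4 → V × Fin 4 :=
  Sum.elim (fun b => (μ v, b)) (fun c => (v, c))

open Classical in
/-- The map on the neighbors of a vertex over `v` given by `f` on those over `v` and its partner
`μ v`, and by adding `k` to the index of the others. -/
noncomputable def pieceMap (f : Fin 4 ⊕ Fin 4 → Fin 4 ⊕ Fin 4) (k : Fin 4) (v : V)
    (q : V × Fin 4) : V × Fin 4 :=
  if q.1 = v then place μ v (f (.inr q.2))
  else if q.1 = μ v then place μ v (f (.inl q.2)) else (q.1, q.2 + k)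

variable {μ σ}

theorem pieceMap_place (hμ : ∀ v, μ v ≠ v) (f : Fin 4 ⊕ Fin 4 → Fin 4 ⊕ Fin 4) (k : Fin 4) (v : V)
    (x : Fin 4 ⊕ Fin 4) : pieceMap μ f k v (place μ v x) = place μ v (f x) := by
  rcases x with b | c <;> simp [pieceMap, place, hμ]

theorem pieceMap_pieceMap (hμ : ∀ v, μ v ≠ v) {f g : Fin 4 ⊕ Fin 4 → Fin 4 ⊕ Fin 4}
    (hgf : ∀ x, g (f x) = x) {k l : Fin 4} (hkl : k + l = 0) (v : V) (q : V × Fin 4) :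
    pieceMap μ g l v (pieceMap μ f k v q) = q := by
  by_cases h : q.1 = v
  · rw [show q = place μ v (.inr q.2) from Prod.ext h rfl, pieceMap_place hμ,
      pieceMap_place hμ, hgf]
  by_cases h' : q.1 = μ v
  · rw [show q = place μ v (.inl q.2) from Prod.ext h' rfl, pieceMap_place hμ,
      pieceMap_place hμ, hgf]
  · simp [pieceMap, h, h', add_assoc, hkl]

/-- The rotation at `p` before the pieces are joined: one cycle for each edge of `G` at `p.1`. -/
noncomputable def pieceRotation (hμ : ∀ v, μ v ≠ v) (p : V × Fin 4) : Perm (V × Fin 4) where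
  toFun := pieceMap μ (pairNext p.2) 1 p.1
  invFun := pieceMap μ (pairPrev p.2) (-1) p.1
  left_inv := pieceMap_pieceMap hμ (pairPrev_pairNext _) (by decide) _
  right_inv := pieceMap_pieceMap hμ (pairNext_pairPrev _) (by decide) _

open Classical in
/-- The map that applies `τ` to the first coordinate of the vertices at the seam of `p`. -/
noncomputable def seamMap (τ : Perm V) (p q : V × Fin 4) : V × Fin 4 :=
  if q.1 ≠ p.1 ∧ q.2 = seamIndex p.2 then (τ q.1, q.2) else q

theorem seamMap_seamMap {τ υ : Perm V} (h : ∀ w, υ (τ w) = w) {p : V × Fin 4} (hτ : τ p.1 = p.1)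
    (q : V × Fin 4) : seamMap υ p (seamMap τ p q) = q := by
  by_cases hq : q.1 ≠ p.1 ∧ q.2 = seamIndex p.2
  · have h1 : τ q.1 ≠ p.1 := fun h' => hq.1 (τ.injective (h'.trans hτ.symm))
    have e : seamMap τ p q = (τ q.1, q.2) := if_pos hq
    rw [e]
    exact (if_pos ⟨h1, hq.2⟩).trans (Prod.ext (h _) rfl)
  · have e : ∀ τ : Perm V, seamMap τ p q = q := fun _ => if_neg hq
    rw [e, e]

/-- The change of rotation at `p` by the cutting and gluing: the rotation arrives at the seam in the
piece of `w` and is redirected to the piece of `σ p.1 w`. -/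
noncomputable def seamPerm (hσ : ∀ v, σ v v = v) (p : V × Fin 4) : Perm (V × Fin 4) where
  toFun := seamMap (σ p.1) p
  invFun := seamMap (σ p.1).symm p
  left_inv := seamMap_seamMap (σ p.1).symm_apply_apply (hσ _)
  right_inv := seamMap_seamMap (σ p.1).apply_symm_apply ((Equiv.symm_apply_eq _).2 (hσ _).symm)

/-- The rotation of `G[K₄]` at `p`, as a permutation of all vertices, for a matching `μ` and cyclic
orders `σ` of the neighbors in `G`. -/
noncomputable def compositionRotation (hμ : ∀ v, μ v ≠ v) (hσ : ∀ v, σ v v = v) (p : V × Fin 4) :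
    Perm (V × Fin 4) :=
  seamPerm hσ p * pieceRotation hμ p

/-- The sign `(-1) ^ a`. -/
def parity : Fin 4 → ℤˣ := ![1, -1, 1, -1]

open Classical in
/-- The signature of the embedding of `G[K₄]`: `-1` on edges within a fibre, and `(-1) ^ (a + b)` on
those from `(v, a)` to `(w, b)` with `v ≠ w`. -/
noncomputable def compositionSignature : Sym2 (V × Fin 4) → ℤˣ :=
  Sym2.lift ⟨fun p q => if p.1 = q.1 then -1 else parity p.2 * parity q.2, fun p q => by
    simp only [eq_comm, mul_comm]⟩

open Classical in
theorem compositionSignature_mk (p q : V × Fin 4) :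
    compositionSignature s(p, q) = if p.1 = q.1 then -1 else parity p.2 * parity q.2 := rfl

variable {hμ : ∀ v, μ v ≠ v} {hσ : ∀ v, σ v v = v}

theorem compositionRotation_apply (p q : V × Fin 4) :
    compositionRotation hμ hσ p q = seamMap (σ p.1) p (pieceMap μ (pairNext p.2) 1 p.1 q) := rfl

theorem compositionRotation_inv_apply (p q : V × Fin 4) :
    (compositionRotation hμ hσ p)⁻¹ q =
      pieceMap μ (pairPrev p.2) (-1) p.1 (seamMap (σ p.1).symm p q) := rfl

theorem composition_adj_top {G : SimpleGraph V} (p q : V × Fin 4) :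
    (G.composition (completeGraph (Fin 4))).Adj p q ↔ G.Adj p.1 q.1 ∨ p.1 = q.1 ∧ p.2 ≠ q.2 :=
  Iff.rfl

theorem pairNext_inr_eq_inr : ∀ a c, pairNext a (.inr c) = .inr a ↔ c = a := by decide
theorem pairNext_inl_ne : ∀ a c, pairNext a (.inl c) ≠ .inr a := by decide

theorem compositionRotation_adj {G : SimpleGraph V} (hadj : ∀ v, G.Adj v (μ v))
    (hσG : ∀ v w, G.Adj v (σ v w) ↔ G.Adj v w) (p q : V × Fin 4) :
    (G.composition (completeGraph (Fin 4))).Adj p (compositionRotation hμ hσ p q) ↔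
      (G.composition (completeGraph (Fin 4))).Adj p q := by
  obtain ⟨v, a⟩ := p
  have hseam : ∀ q : V × Fin 4, (G.composition (completeGraph (Fin 4))).Adj (v, a)
      (seamPerm hσ (v, a) q) ↔ (G.composition (completeGraph (Fin 4))).Adj (v, a) q := by
    intro q
    by_cases h : q.1 ≠ v ∧ q.2 = seamIndex a
    · have e : seamPerm hσ (v, a) q = (σ v q.1, q.2) := if_pos h
      have h1 : v ≠ σ v q.1 := fun h' => h.1 ((σ v).injective (h'.symm.trans (hσ v).symm))
      simp [e, composition_adj_top, hσG, h.1.symm, h1]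
    · have e : seamPerm hσ (v, a) q = q := if_neg h
      rw [e]
  have hplace : ∀ x, (G.composition (completeGraph (Fin 4))).Adj (v, a) (place μ v x) ↔
      x ≠ .inr a := by
    rintro (b | c)
    · simp [place, composition_adj_top, hadj]
    · simp [place, composition_adj_top, eq_comm]
  rw [compositionRotation, Perm.mul_apply, hseam]
  obtain ⟨w, b⟩ := q
  by_cases h : w = v
  · have e : pieceRotation hμ (v, a) (w, b) = place μ v (pairNext a (.inr b)) := if_pos h
    rw [e, hplace, composition_adj_top]
    simp [h, pairNext_inr_eq_inr, eq_comm (a := a)]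
  by_cases h' : w = μ v
  · have e : pieceRotation hμ (v, a) (w, b) = place μ v (pairNext a (.inl b)) :=
      (if_neg h).trans (if_pos h')
    rw [e, hplace, composition_adj_top]
    simp [h', pairNext_inl_ne, hadj]
  · have e : pieceRotation hμ (v, a) (w, b) = (w, b + 1) := (if_neg h).trans (if_neg h')
    simp [e, composition_adj_top, Ne.symm h]

/-! ### Values of the rotation and its inverse

These lemmas cover each place in the rotation at `(v, a)`. Those at the seam, and those between two
consecutive darts of a `K_{4,4}` with nothing inserted, are the same for matching edges and for other
edges, so that the faces affected by the gluing need no distinction of the kinds of pieces involved. -/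

open CellularEmbedding

theorem compositionRotation_inner (v : V) (a b : Fin 4)
    (hb : pairNext a (.inr b) ≠ .inl (seamIndex a)) :
    compositionRotation hμ hσ (v, a) (v, b) = place μ v (pairNext a (.inr b)) := by
  rw [compositionRotation_apply, pieceMap, if_pos rfl]
  refine if_neg ?_
  rcases hc : pairNext a (.inr b) with c | c
  · rw [hc] at hb
    exact fun h => hb (congrArg _ h.2)
  · exact fun h => h.1 rfl

theorem compositionRotation_partner {v w : V} {a b : Fin 4} (hw : w = μ v)
    (hb : b + 1 ≠ seamIndex a) :
    compositionRotation hμ hσ (v, a) (w, b) = place μ v (pairNext a (.inl b)) := by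
  have key : ∀ a b, b + 1 ≠ seamIndex a → pairNext a (.inl b) ≠ .inl (seamIndex a) := by decide
  have hb := key a b hb
  rw [compositionRotation_apply, pieceMap, if_neg (hw ▸ hμ v), if_pos hw]
  refine if_neg ?_
  rcases hc : pairNext a (.inl b) with c | c
  · rw [hc] at hb
    exact fun h => hb (congrArg _ h.2)
  · exact fun h => h.1 rfl

theorem pieceMap_inl {f : Fin 4 ⊕ Fin 4 → Fin 4 ⊕ Fin 4} {k b : Fin 4} {v w : V} (hw : w ≠ v)
    (h : f (.inl b) = .inl (b + k) ∨ w ≠ μ v) : pieceMap μ f k v (w, b) = (w, b + k) := by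
  by_cases h' : w = μ v
  · rw [pieceMap, if_neg hw, if_pos h', h.resolve_right (not_not.2 h'), h']; rfl
  · rw [pieceMap, if_neg hw, if_neg h']

theorem compositionRotation_seam {v w : V} {a b : Fin 4} (hw : w ≠ v) (hb : b + 1 = seamIndex a) :
    compositionRotation hμ hσ (v, a) (w, b) = (σ v w, b + 1) := by
  have key : ∀ a b, b + 1 = seamIndex a → pairNext a (.inl b) = .inl (b + 1) := by decide
  rw [compositionRotation_apply, pieceMap_inl hw (.inl (key a b hb))]
  exact if_pos ⟨hw, hb⟩

theorem compositionRotation_succ {v w : V} {a b : Fin 4} (hw : w ≠ v) (hb : b + 1 ≠ seamIndex a)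
    (h : pairNext a (.inl b) = .inl (b + 1) ∨ w ≠ μ v) :
    compositionRotation hμ hσ (v, a) (w, b) = (w, b + 1) := by
  rw [compositionRotation_apply, pieceMap_inl hw h]
  exact if_neg fun h => hb h.2

theorem compositionRotation_pair {v w : V} {a b : Fin 4} (hw : w ≠ v) (hb : b + 1 ≠ seamIndex a)
    (h : pairNext a (.inl b) = .inl (b + 1)) :
    compositionRotation hμ hσ (v, a) (w, b) = (w, b + 1) :=
  compositionRotation_succ hw hb (.inl h)

theorem compositionRotation_other {v w : V} {a b : Fin 4} (hw : w ≠ v) (hb : b + 1 ≠ seamIndex a)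
    (h : w ≠ μ v) : compositionRotation hμ hσ (v, a) (w, b) = (w, b + 1) :=
  compositionRotation_succ hw hb (.inr h)

theorem compositionRotation_inv_inner (v : V) (a b : Fin 4) :
    (compositionRotation hμ hσ (v, a))⁻¹ (v, b) = place μ v (pairPrev a (.inr b)) := by
  rw [compositionRotation_inv_apply]
  have : seamMap (σ v).symm (v, a) (v, b) = (v, b) := if_neg fun h => h.1 rfl
  rw [this]
  exact if_pos rfl

theorem compositionRotation_inv_partner {v w : V} {a b : Fin 4} (hw : w = μ v)
    (hb : b ≠ seamIndex a) :
    (compositionRotation hμ hσ (v, a))⁻¹ (w, b) = place μ v (pairPrev a (.inl b)) := by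
  rw [compositionRotation_inv_apply]
  have : seamMap (σ v).symm (v, a) (w, b) = (w, b) := if_neg fun h => hb h.2
  rw [this]
  exact (if_neg (hw ▸ hμ v)).trans (if_pos hw)

theorem compositionRotation_inv_seam {v w : V} {a b : Fin 4} (hw : w ≠ v) (hb : b = seamIndex a) :
    (compositionRotation hμ hσ (v, a))⁻¹ (w, b) = ((σ v).symm w, b - 1) := by
  rw [Perm.inv_eq_iff_eq]
  rw [compositionRotation_seam, sub_add_cancel, apply_symm_apply]
  · exact fun e => hw (by rw [← hσ v, ← (σ v).symm_apply_eq, e])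
  · rw [sub_add_cancel, hb]

theorem compositionRotation_inv_pred {v w : V} {a b : Fin 4} (hw : w ≠ v) (hb : b ≠ seamIndex a)
    (h : pairNext a (.inl (b - 1)) = .inl b ∨ w ≠ μ v) :
    (compositionRotation hμ hσ (v, a))⁻¹ (w, b) = (w, b - 1) := by
  rw [Perm.inv_eq_iff_eq]
  rw [compositionRotation_succ hw, sub_add_cancel]
  · rwa [sub_add_cancel]
  · rwa [sub_add_cancel]

theorem compositionRotation_inv_pair {v w : V} {a b : Fin 4} (hw : w ≠ v) (hb : b ≠ seamIndex a)
    (h : pairNext a (.inl (b - 1)) = .inl b) :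
    (compositionRotation hμ hσ (v, a))⁻¹ (w, b) = (w, b - 1) :=
  compositionRotation_inv_pred hw hb (.inl h)

theorem compositionRotation_inv_other {v w : V} {a b : Fin 4} (hw : w ≠ v) (hb : b ≠ seamIndex a)
    (h : w ≠ μ v) : (compositionRotation hμ hσ (v, a))⁻¹ (w, b) = (w, b - 1) :=
  compositionRotation_inv_pred hw hb (.inr h)

/-! ### Faces -/

/-- All faces are quadrilaterals. For each kind of edge, indices `a`, `b` and local orientation `s`,
the face is traced explicitly. A face that uses a seam at `v` alternates between the fibre of `v` and
the fibres of two neighbors `w` and `σ v w`, and it closes up since at its second vertex over `v` the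
reversed local orientation makes it return from `σ v w` to `w`. -/
theorem compositionRotation_face {G : SimpleGraph V} (hμμ : ∀ v, μ (μ v) = v) (p q : V × Fin 4)
    (s : ℤˣ) (hpq : (G.composition (completeGraph (Fin 4))).Adj p q) :
    (traceStep (compositionRotation hμ hσ) compositionSignature)^[4] ((p, q), s) = ((p, q), s) ∧
      (traceStep (compositionRotation hμ hσ) compositionSignature ((p, q), s)).1.2 ≠ p ∧
      (traceStep (compositionRotation hμ hσ) compositionSignature
        (traceStep (compositionRotation hμ hσ) compositionSignature ((p, q), s))).1.2 ≠ q := by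
  obtain ⟨v, a⟩ := p
  obtain ⟨w, b⟩ := q
  -- needed to evaluate `0 - 1`, which `simp` rewrites to `-1`
  have neg1 : (-1 : Fin 4) = 3 := rfl
  by_cases h : w = v
  · subst h
    have hab : a ≠ b := by simpa [composition_adj_top] using hpq
    have h1 := hμ w
    have h2 := h1.symm
    have h3 : w = μ (μ w) := (hμμ w).symm
    rcases Int.units_eq_one_or s with rfl | rfl <;> fin_cases a <;> fin_cases b <;>
    first
    | exact absurd rfl hab
    | simp (disch := first | assumption | rfl | decide)
        [traceStep, compositionSignature_mk, compositionRotation_partner,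
        compositionRotation_inv_partner, compositionRotation_inner, compositionRotation_inv_inner,
        place, pairNext, pairPrev, parity, h1, h2, ← h3]
  have hwv : v ≠ w := Ne.symm h
  have n1 : σ v w ≠ v := fun e => h ((σ v).injective (e.trans (hσ v).symm))
  have n2 : (σ v).symm w ≠ v := fun e => h (by rw [← hσ v, ← (σ v).symm_apply_eq, e])
  have n3 : σ w v ≠ w := fun e => hwv ((σ w).injective (e.trans (hσ w).symm))
  have n4 : (σ w).symm v ≠ w := fun e => hwv (by rw [← hσ w, ← (σ w).symm_apply_eq, e])
  -- both directions are needed, as `assumption` discharges the side conditions of the rewrite rules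
  have m1 := n1.symm
  have m2 := n2.symm
  have m3 := n3.symm
  have m4 := n4.symm
  by_cases h' : w = μ v
  · have h4 : v = μ w := by rw [h', hμμ]
    rcases Int.units_eq_one_or s with rfl | rfl <;> fin_cases a <;> fin_cases b <;>
    simp (disch := first | assumption | decide)
      [traceStep, compositionSignature_mk, compositionRotation_seam, compositionRotation_pair,
      compositionRotation_inv_seam, compositionRotation_inv_pair, compositionRotation_partner,
      compositionRotation_inv_partner, compositionRotation_inner, compositionRotation_inv_inner,
      place, pairNext, pairPrev, parity, neg1, h, hwv, ← h', ← h4, n1, n2, n3, n4,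
      n1.symm, n2.symm, n3.symm, n4.symm]
  · have h4 : ¬ v = μ w := fun e => h' (by rw [e, hμμ])
    rcases Int.units_eq_one_or s with rfl | rfl <;> fin_cases a <;> fin_cases b <;>
    simp (disch := first | assumption | decide)
      [traceStep, compositionSignature_mk, compositionRotation_seam, compositionRotation_pair,
      compositionRotation_other, compositionRotation_inv_seam, compositionRotation_inv_pair,
      compositionRotation_inv_other,
      parity, neg1, h, hwv, n1, n2, n3, n4,
      n1.symm, n2.symm, n3.symm, n4.symm]

/-! ### Connectedness of the rotation -/

theorem sameCycle_place (v : V) (a : Fin 4) {x : Fin 4 ⊕ Fin 4} (hx : x ≠ .inr a) :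
    (compositionRotation hμ hσ (v, a)).SameCycle (μ v, seamIndex a) (place μ v x) := by
  have hcycle : ∀ a x, x ≠ Sum.inr a → ∃ k : Fin 7, (pairNext a)^[k] (.inl (seamIndex a)) = x := by
    decide
  obtain ⟨k, rfl⟩ := hcycle a x hx
  clear hx
  induction (k : ℕ) with
  | zero => exact .refl _ _
  | succ k ih =>
    rw [Function.iterate_succ_apply']
    by_cases h : pairNext a ((pairNext a)^[k] (.inl (seamIndex a))) = .inl (seamIndex a)
    · rw [h]; exact .refl _ _
    · have hstep : compositionRotation hμ hσ (v, a)
          (place μ v ((pairNext a)^[k] (.inl (seamIndex a)))) =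
          place μ v (pairNext a ((pairNext a)^[k] (.inl (seamIndex a)))) := by
        have key : ∀ a b, pairNext a (.inl b) ≠ .inl (seamIndex a) → b + 1 ≠ seamIndex a := by
          decide
        rcases hy : (pairNext a)^[k] (.inl (seamIndex a)) with b | c
        · rw [hy] at h
          exact compositionRotation_partner rfl (key a b h)
        · rw [hy] at h
          exact compositionRotation_inner v a c h
      rw [← hstep]
      exact ih.apply_right

theorem sameCycle_piece {v w : V} (hw : w ≠ v) (a b : Fin 4) :
    (compositionRotation hμ hσ (v, a)).SameCycle (w, seamIndex a) (w, b) := by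
  by_cases h : w = μ v
  · subst h
    exact sameCycle_place v a (x := .inl b) Sum.inl_ne_inr
  have hb : ∃ k : Fin 4, (· + 1)^[k] (seamIndex a) = b := by revert a b; decide
  obtain ⟨k, rfl⟩ := hb
  induction (k : ℕ) with
  | zero => exact .refl _ _
  | succ k ih =>
    rw [Function.iterate_succ_apply']
    by_cases h1 : (· + 1)^[k] (seamIndex a) + 1 = seamIndex a
    · rw [h1]
    · rw [← compositionRotation_other (hσ := hσ) hw h1 h]
      exact ih.apply_right

/-- At the seam, the rotation leads from the piece of each neighbor `u` to that of `σ v u`. -/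
theorem sameCycle_seam [Finite V] {v w w' : V} (hw : w ≠ v) (h : (σ v).SameCycle w w') (a : Fin 4) :
    (compositionRotation hμ hσ (v, a)).SameCycle (w, seamIndex a) (w', seamIndex a) := by
  have hstep : ∀ u, u ≠ v → (compositionRotation hμ hσ (v, a)).SameCycle (u, seamIndex a)
      (σ v u, seamIndex a) := by
    intro u hu
    -- the dart before the seam in the piece of `u` is followed by the one after the seam in that of
    -- `σ v u`
    have := (sameCycle_piece (hμ := hμ) (hσ := hσ) hu a (seamIndex a - 1)).apply_right
    rwa [compositionRotation_seam hu (sub_add_cancel _ _), sub_add_cancel] at this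
  obtain ⟨n, rfl⟩ := h.exists_nat_pow_eq
  induction n with
  | zero => exact .refl _ _
  | succ n ih =>
    have hn : (σ v ^ n) w ≠ v := fun e => hw <| (σ v ^ n).injective <|
      e.trans (Function.IsFixedPt.perm_pow (hσ v) n).symm
    rw [pow_succ', Perm.mul_apply]
    exact (ih ⟨n, rfl⟩).trans (hstep _ hn)

theorem compositionRotation_sameCycle [Finite V] {G : SimpleGraph V} (hadj : ∀ v, G.Adj v (μ v))
    (hcyc : ∀ v w w', G.Adj v w → G.Adj v w' → (σ v).SameCycle w w') (p q q' : V × Fin 4)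
    (hq : (G.composition (completeGraph (Fin 4))).Adj p q)
    (hq' : (G.composition (completeGraph (Fin 4))).Adj p q') :
    (compositionRotation hμ hσ p).SameCycle q q' := by
  have key : ∀ q, (G.composition (completeGraph (Fin 4))).Adj p q →
      (compositionRotation hμ hσ p).SameCycle (μ p.1, seamIndex p.2) q := by
    intro q hq
    rcases hq with h | ⟨h, h'⟩
    · exact (sameCycle_seam (hμ p.1) (hcyc _ _ _ (hadj _) h) _).trans (sameCycle_piece h.ne' _ _)
    · have := sameCycle_place (hμ := hμ) (hσ := hσ) p.1 p.2 (x := .inr q.2)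
        (fun e => h' (Sum.inr_injective e).symm)
      rwa [show place μ p.1 (.inr q.2) = q from Prod.ext h rfl] at this
  exact (key q hq).symm.trans (key q' hq')

end Composition
end SimpleGraph

theorem theorem3p2 {V : Type*} [Finite V] (G : SimpleGraph V)
    (hM : ∃ M : G.Subgraph, M.IsPerfectMatching)
    (hC : ∃ (v : V) (c : G.Walk v v), c.IsCycle) :
    ∃ E : (G.composition (SimpleGraph.completeGraph (Fin 4))).CellularEmbedding,
      E.IsQuadrangular ∧ E.IsNonorientable := by
  obtain ⟨M, hM⟩ := hM
  choose μ hμ using fun v => (SimpleGraph.Subgraph.isPerfectMatching_iff.1 hM v)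
  have hadj : ∀ v, G.Adj v (μ v) := fun v => (hμ v).1.adj_sub
  have hne : ∀ v, μ v ≠ v := fun v => (hadj v).ne'
  have hμμ : ∀ v, μ (μ v) = v := fun v => ((hμ (μ v)).2 v (hμ v).1.symm).symm
  choose σ hσ hsupp using fun v => (Set.to_countable (G.neighborSet v)).exists_cycleOn
  have hfix : ∀ v, σ v v = v := fun v => by
    by_contra h
    exact G.loopless.irrefl v (hsupp v h)
  have hσG : ∀ v w, G.Adj v (σ v w) ↔ G.Adj v w := fun v w => (hσ v).apply_mem_iff
  have hcyc := SimpleGraph.compositionRotation_sameCycle (hμ := hne) (hσ := hfix) hadj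
    fun v w w' h h' => (hσ v).2 h h'
  refine ⟨SimpleGraph.CellularEmbedding.ofNeighborRotation _
      (SimpleGraph.compositionRotation_adj hadj hσG) hcyc SimpleGraph.compositionSignature,
    SimpleGraph.CellularEmbedding.isQuadrangular_ofNeighborRotation hcyc _
    (fun p => ⟨(μ p.1, p.2), .inl (hadj _)⟩)
    (fun p q s => SimpleGraph.compositionRotation_face hμμ p q s), fun h => ?_⟩
  obtain ⟨v, -⟩ := hC
  have hin : ∀ a b : Fin 4, a ≠ b →
      (G.composition (SimpleGraph.completeGraph (Fin 4))).Adj (v, a) (v, b) :=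
    fun a b hab => .inr ⟨rfl, hab⟩
  -- a triangle within a fibre has three edges of signature `-1`
  have := h (v, 0) (.cons (hin 0 1 (by decide)) (.cons (hin 1 2 (by decide))
    (.cons (hin 2 0 (by decide)) .nil)))
  simp [SimpleGraph.CellularEmbedding.walkSign, SimpleGraph.CellularEmbedding.ofNeighborRotation,
    SimpleGraph.compositionSignature_mk] at this
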